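/- **Theorem (Decoding the Hadamard code with $\mathrm{QNC}^0[\oplus]$).** For $k\in\mathbb N$ let $n=2^k$ and let $H:\mathbb F_2^k\to\mathbb F_2^{n}$, $H(x)=(\langle x,z\rangle)_{z\in\mathbb F_2^k}$, be the Hadamard code; let $d$ denote the Hamming distance. A quantum circuit with classical parity gates has classical input bits, qubits initialized to $|0\rangle$ and classical memory bits initialized to $0$. It consists of a finite sequence of layers of simultaneous operations. The operations of a layer act on pairwise disjoint sets of qubits, write to distinct memory bits, and read the values that the classical bits have before the layer; a classical bit may be read by any number of operations. The operations are: arbitrary one- and two-qubit unitary gates, possibly controlled by one classical bit; measurements of a qubit in the computational basis, the outcome being stored in a memory bit; and classical parity gates of unbounded fan-in, which store the sum modulo $2$ of a set of classical bits (inputs or memory) in a memory bit. The output is read off from designated classical bits. The depth is the number of layers; the size is the total number of qubits, memory bits and operations. A family of such circuits is a $\mathrm{QNC}^0[\oplus]$ family if its depth is bounded by a constant and its size by a polynomial in the number of input bits. There are a $\mathrm{QNC}^0[\oplus]$ family $(\mathcal C_n)_{n=2^k,\,k\in\mathbb N}$, where $\mathcal C_n$ has $n$ input bits and $k$ output bits,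 and an absolute constant $c>0$ such that the following holds. Let $k\in\mathbb N$, $n=2^k$ and $\varepsilon\in(0,1/2]$. Then for any $y\in\mathbb F_2^n$ and any $x\in\mathbb F_2^k$ with $d(y,H(x))\le(\tfrac12-\varepsilon)n$, on input $y$ the circuit $\mathcal C_n$ returns $x$ with probability at least $c\,\varepsilon^2$. -/

import Mathlib

/-! ### The Hadamard code -/

/-- The Hadamard code: the message `x ∈ 𝔽₂ᵏ` is encoded as the word of length `n = 2ᵏ`, with
coordinates labelled by `𝔽₂ᵏ`, whose `z`-th coordinate is `⟨x, z⟩ = zᵀ x`. -/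
def hadamardCode {k : ℕ} (x : Fin k → ZMod 2) : (Fin k → ZMod 2) → ZMod 2 :=
  fun z => dotProduct z x

/-! ### Quantum circuits with classical parity gates

A circuit has classical input bits (labelled by `ι`, read-only), qubits (labelled by `Q`,
initially all `|0⟩`) and classical memory cells (labelled by `M`, initially all `0`).
A classical wire is an element of `ι ⊕ M`; it can be read by arbitrarily many gates. -/

namespace ParityQC

/-- The elementary operations. -/
inductive Op (ι Q M : Type) : Type
  /-- A single-qubit unitary on the qubit `q`; with `ctrl = some w` it is applied only if the
  classical wire `w` carries the value `1`. -/
  | gate₁ (ctrl : Option (ι ⊕ M)) (U : Matrix.unitaryGroup (ZMod 2) ℂ) (q : Q) : Op ι Q M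
  /-- A two-qubit unitary on the distinct qubits `q, r`, possibly classically controlled. -/
  | gate₂ (ctrl : Option (ι ⊕ M)) (U : Matrix.unitaryGroup (ZMod 2 × ZMod 2) ℂ) (q r : Q)
      (hqr : q ≠ r) : Op ι Q M
  /-- Measurement of the qubit `q` in the computational basis, the outcome is stored in `c`. -/
  | measure (q : Q) (c : M) : Op ι Q M
  /-- The classical parity gate of unbounded fan-in: the sum modulo 2 of the wires in `S` is
  stored in `c`. -/
  | parity (S : Finset (ι ⊕ M)) (c : M) : Op ι Q M

namespace Op

variable {ι Q M : Type}

/-- The qubits on which an operation acts. -/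
def qubits : Op ι Q M → Set Q
  | gate₁ _ _ q => {q}
  | gate₂ _ _ q r _ => {q, r}
  | measure q _ => {q}
  | parity _ _ => ∅

/-- The classical cells to which an operation writes. -/
def cells : Op ι Q M → Set M
  | gate₁ _ _ _ => ∅
  | gate₂ _ _ _ _ _ => ∅
  | measure _ c => {c}
  | parity _ c => {c}

/-- Two operations can be carried out at the same time: they act on disjoint sets of qubits and
do not write to the same cell. -/
def Compatible (a b : Op ι Q M) : Prop :=
  Disjoint a.qubits b.qubits ∧ Disjoint a.cells b.cells

end Op

/-- A circuit with input bits labelled by `ι` and output bits labelled by `κ`: a finite sequence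
of layers, each layer being a list of pairwise compatible operations, and a choice of the
classical wires that carry the output. -/
structure Circuit (ι κ : Type) : Type 1 where
  Qubit : Type
  Cell : Type
  [fintypeQubit : Fintype Qubit]
  [decEqQubit : DecidableEq Qubit]
  [fintypeCell : Fintype Cell]
  [decEqCell : DecidableEq Cell]
  layers : List (List (Op ι Qubit Cell))
  compatible : ∀ L ∈ layers, L.Pairwise Op.Compatible
  out : κ → ι ⊕ Cell

attribute [instance] Circuit.fintypeQubit Circuit.decEqQubit Circuit.fintypeCell
  Circuit.decEqCell

/-! ### Semantics -/

/-- The (not necessarily normalized) state vectors, by their amplitudes in the computational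
basis. -/
abbrev QState (Q : Type) : Type := (Q → ZMod 2) → ℂ

section Semantics

variable {ι κ Q M : Type}

/-- The action of a unitary on the qubit `q`. -/
noncomputable def apply₁ [DecidableEq Q] (U : Matrix.unitaryGroup (ZMod 2) ℂ) (q : Q)
    (ψ : QState Q) : QState Q :=
  fun u => ∑ b : ZMod 2, U.1 (u q) b * ψ (Function.update u q b)

/-- The action of a unitary on the qubits `q` and `r`. -/
noncomputable def apply₂ [DecidableEq Q] (U : Matrix.unitaryGroup (ZMod 2 × ZMod 2) ℂ) (q r : Q)
    (ψ : QState Q) : QState Q :=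
  fun u => ∑ b : ZMod 2 × ZMod 2,
    U.1 (u q, u r) b * ψ (Function.update (Function.update u q b.1) r b.2)

/-- The projection onto the states in which the qubit `q` has the value `b`. -/
noncomputable def proj (q : Q) (b : ZMod 2) (ψ : QState Q) : QState Q :=
  fun u => if u q = b then ψ u else 0

/-- The state `|0⋯0⟩`. -/
noncomputable def zeroState [Fintype Q] : QState Q :=
  fun u => if u = 0 then 1 else 0

/-- The square of the Euclidean norm of a state vector. -/
noncomputable def weight [Fintype Q] [DecidableEq Q] (ψ : QState Q) : ℝ :=
  ∑ u : Q → ZMod 2, ‖ψ u‖ ^ 2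

/-- Whether an operation with classical control `ctrl` is carried out, when the classical wires
carry the values `w`. -/
def Active (w : ι ⊕ M → ZMod 2) : Option (ι ⊕ M) → Prop
  | none => True
  | some c => w c = 1

/-- A branch of the computation: the content of the classical cells, and the unnormalized state
of the qubits. The probability of the branch is the weight of that state. -/
abbrev Branch (Q M : Type) : Type := (M → ZMod 2) × QState Q

open Classical in
/-- The branches that arise from a branch by an operation that reads the values `w` on the
classical wires. A measurement splits a branch into two. -/
noncomputable def Op.run [DecidableEq Q] [DecidableEq M] (w : ι ⊕ M → ZMod 2) :
    Op ι Q M → Branch Q M → List (Branch Q M)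
  | .gate₁ ctrl U q, (m, ψ) => [(m, if Active w ctrl then apply₁ U q ψ else ψ)]
  | .gate₂ ctrl U q r _, (m, ψ) => [(m, if Active w ctrl then apply₂ U q r ψ else ψ)]
  | .measure q c, (m, ψ) =>
      [(Function.update m c 0, proj q 0 ψ), (Function.update m c 1, proj q 1 ψ)]
  | .parity S c, (m, ψ) => [(Function.update m c (∑ v ∈ S, w v), ψ)]

/-- The branches that arise from the branch `B` by a layer, on the input `y`. All operations in
the layer read the content that the cells have before the layer. -/
noncomputable def runLayer [DecidableEq Q] [DecidableEq M] (y : ι → ZMod 2)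
    (L : List (Op ι Q M)) (B : Branch Q M) : List (Branch Q M) :=
  L.foldl (fun Bs o => Bs.flatMap (o.run (Sum.elim y B.1))) [B]

end Semantics

namespace Circuit

variable {ι κ : Type}

/-- The depth: the number of layers. -/
def depth (C : Circuit ι κ) : ℕ := C.layers.length

/-- The size: the number of qubits, classical cells and operations. (The fan-in of every parity
gate is at most the number of input bits plus the number of cells.) -/
def size (C : Circuit ι κ) : ℕ :=
  Fintype.card C.Qubit + Fintype.card C.Cell + (C.layers.map List.length).sum

/-- All branches at the end of the computation on the input `y`. -/
noncomputable def branches (C : Circuit ι κ) (y : ι → ZMod 2) :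
    List (Branch C.Qubit C.Cell) :=
  C.layers.foldl (fun Bs L => Bs.flatMap (runLayer y L)) [(0, zeroState)]

open Classical in
/-- The probability that the circuit `C` returns `x` on the input `y`. -/
noncomputable def prob (C : Circuit ι κ) (y : ι → ZMod 2) (x : κ → ZMod 2) : ℝ :=
  ((C.branches y).map fun B =>
    if (fun j => Sum.elim y B.1 (C.out j)) = x then weight B.2 else 0).sum

end Circuit

/-- `QNC⁰[⊕]` families: the depth is bounded by a constant and the size by a polynomial in the
number of input bits. -/
def IsQNC0Parity {ι κ : ℕ → Type} [∀ k, Fintype (ι k)] (C : ∀ k, Circuit (ι k) (κ k)) : Prop :=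
  (∃ d : ℕ, ∀ k, (C k).depth ≤ d) ∧
    ∃ p : Polynomial ℕ, ∀ k, (C k).size ≤ p.eval (Fintype.card (ι k))

end ParityQC

/-! The algorithm is that of Bernstein and Vazirani. A uniform superposition over `z` with phases
`(-1)^(y z)`, read in the Hadamard basis, gives `x` with probability `(2⁻ᵏ ∑_z (-1)^(⟨x,z⟩ + y z))²
= (1 - 2d/n)²`, where `d` is the distance of `y` from the codeword of `x`. This is at least `4ε²`.
The difficulty is to apply the phases in constant depth.

The phase is a product over `w` with `y w = 1` of `exp(iπ[w = z])`, and orthogonality of characters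
gives `[w = z] = 2⁻ᵏ ∑_s (-1)^(⟨s,w⟩ + ⟨s,z⟩)`. Hence (`prod_phase`) it is a product of `n²`
commuting rotations, each controlled by a single input bit `y w` and acting on a single parity
`⟨s,z⟩`. They can be simultaneous once each pair `(s,w)` has its own qubit holding `⟨s,z⟩`.

So `z` is replaced by a codeword `enc z` that contains many copies of its bits and all partial sums
of these parities. This code has sparse checks: from the uniform superposition of all words, three
CNOT layers compute the syndrome. Measuring it leaves a superposition of a coset of the code, and
flips chosen by classical parity gates move the coset to the code (`checkMap_eq_zero_iff`,
`checkMap_surjective`). After the phases and the Hadamard gates, the transpose of `enc`, again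
computed by parity gates, turns the measured word into the output (`sum_mul_enc`,
`Scheme.prob_circuit_of_encoding`). -/

namespace ParityQC

theorem eq_zero_or_one : ∀ b : ZMod 2, b = 0 ∨ b = 1 := by decide

theorem add_eq_zero_iff_eq {α : Type*} (f g : α → ZMod 2) : f + g = 0 ↔ f = g := by
  simp [funext_iff, CharTwo.add_eq_zero]

/-! ### Branches of a computation -/

theorem foldl_flatMap {α β : Type*} (g : β → α → List α) (L : List β) (l : List α) :
    L.foldl (fun s o => s.flatMap (g o)) l =
      l.flatMap fun a => L.foldl (fun s o => s.flatMap (g o)) [a] := by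
  induction L generalizing l with
  | nil => simp
  | cons o L ih =>
    simp only [List.foldl_cons]
    rw [ih, List.flatMap_assoc]
    congr 1
    funext a
    rw [ih ([a].flatMap (g o))]
    simp

section Semantics

variable {ι Q M : Type} [DecidableEq Q] [DecidableEq M]

/-- The sum of `f` over all branches that arise from the branch `B` by the layers `Ls`. -/
noncomputable def value (y : ι → ZMod 2) (f : Branch Q M → ℝ) :
    List (List (Op ι Q M)) → Branch Q M → ℝ
  | [], B => f B
  | L :: Ls, B => ((runLayer y L B).map (value y f Ls)).sum

/-- Replaces the growing list of branches by a backward recursion, so that layers can be evaluated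
one at a time. -/
theorem sum_foldl_runLayer (y : ι → ZMod 2) (f : Branch Q M → ℝ) (Ls : List (List (Op ι Q M)))
    (l : List (Branch Q M)) :
    ((Ls.foldl (fun Bs L => Bs.flatMap (runLayer y L)) l).map f).sum =
      (l.map (value y f Ls)).sum := by
  induction Ls generalizing l with
  | nil => rfl
  | cons L Ls ih =>
    rw [List.foldl_cons, ih]
    induction l with
    | nil => rfl
    | cons B l ihl => simp [value, ihl]

theorem value_cons_of_eq_singleton {y : ι → ZMod 2} {f : Branch Q M → ℝ} {L : List (Op ι Q M)}
    {Ls : List (List (Op ι Q M))} {B B' : Branch Q M} (h : runLayer y L B = [B']) :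
    value y f (L :: Ls) B = value y f Ls B' := by
  simp [value, h]

theorem apply₁_one (q : Q) (ψ : QState Q) : apply₁ 1 q ψ = ψ := by
  funext u
  simp [apply₁, Matrix.one_apply]

open Classical in
/-- The unitary that a classically controlled gate applies. -/
noncomputable def controlled {n : Type} [Fintype n] [DecidableEq n] (w : ι ⊕ M → ZMod 2)
    (ctrl : Option (ι ⊕ M)) (U : Matrix.unitaryGroup n ℂ) : Matrix.unitaryGroup n ℂ :=
  if Active w ctrl then U else 1

theorem run_gate₁ (w : ι ⊕ M → ZMod 2) (ctrl : Option (ι ⊕ M))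
    (U : Matrix.unitaryGroup (ZMod 2) ℂ) (q : Q) (m : M → ZMod 2) (ψ : QState Q) :
    (Op.gate₁ ctrl U q).run w (m, ψ) = [(m, apply₁ (controlled w ctrl U) q ψ)] := by
  by_cases h : Active w ctrl <;> simp [Op.run, controlled, h, apply₁_one]

theorem runLayer_gate₁ {I : Type} (y : ι → ZMod 2) (ctrl : I → Option (ι ⊕ M))
    (U : I → Matrix.unitaryGroup (ZMod 2) ℂ) (q : I → Q) (l : List I) (m : M → ZMod 2)
    (ψ : QState Q) :
    runLayer y (l.map fun i => Op.gate₁ (ctrl i) (U i) (q i)) (m, ψ) =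
      [(m, l.foldl (fun φ i => apply₁ (controlled (Sum.elim y m) (ctrl i) (U i)) (q i) φ) ψ)] := by
  unfold runLayer
  induction l generalizing ψ with
  | nil => rfl
  | cons i l ih =>
    simp only [List.map_cons, List.foldl_cons, List.flatMap_cons, List.flatMap_nil,
      List.append_nil, run_gate₁]
    exact ih _

theorem runLayer_parity {I : Type} (y : ι → ZMod 2) (S : I → Finset (ι ⊕ M)) (c : I → M)
    (l : List I) (m : M → ZMod 2) (ψ : QState Q) :
    runLayer y (l.map fun i => Op.parity (S i) (c i)) (m, ψ) =
      [(l.foldl (fun m' i => Function.update m' (c i) (∑ v ∈ S i, Sum.elim y m v)) m, ψ)] := by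
  unfold runLayer
  suffices h : ∀ m' : M → ZMod 2,
      (l.map fun i => Op.parity (S i) (c i)).foldl
        (fun Bs o => Bs.flatMap (o.run (Sum.elim y m))) [((m', ψ) : Branch Q M)] =
      [(l.foldl (fun m' i => Function.update m' (c i) (∑ v ∈ S i, Sum.elim y m v)) m', ψ)] from
    h m
  induction l with
  | nil => exact fun _ => rfl
  | cons i l ih =>
    intro m'
    simp only [List.map_cons, List.foldl_cons, List.flatMap_cons, List.flatMap_nil,
      List.append_nil, Op.run]
    exact ih _

/-- The sum over the branches of a layer of measurements of a function that is local in the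
measured qubits. -/
theorem sum_runLayer_measure [Fintype Q] {I : Type} (y : ι → ZMod 2) (q : I → Q) (c : I → M)
    (Γ : (M → ZMod 2) → (Q → ZMod 2) → QState Q → ℝ)
    (hΓ : ∀ m u ψ i b, Γ m u (proj (q i) b ψ) = if u (q i) = b then Γ m u ψ else 0)
    (l : List I) (m : M → ZMod 2) (ψ : QState Q) :
    ((runLayer y (l.map fun i => Op.measure (q i) (c i)) (m, ψ)).map
        fun B => ∑ u, Γ B.1 u B.2).sum =
      ∑ u, Γ (l.foldl (fun m' i => Function.update m' (c i) (u (q i))) m) u ψ := by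
  unfold runLayer
  -- Measurements read no wires; freeing `w` from `m` lets the induction change `m`.
  generalize Sum.elim y (m, ψ).1 = w
  induction l generalizing m ψ with
  | nil => simp
  | cons i l ih =>
    simp only [List.map_cons, List.foldl_cons]
    rw [foldl_flatMap]
    simp only [List.flatMap_cons, List.flatMap_nil, List.append_nil, Op.run, List.map_append,
      List.sum_append, ih, hΓ]
    rw [← Finset.sum_add_distrib]
    refine Finset.sum_congr rfl fun u _ => ?_
    obtain h | h := eq_zero_or_one (u (q i)) <;> simp [h]

end Semantics

/-! ### Writing to the classical cells -/

section Cells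

variable {I M : Type} [DecidableEq M]

theorem foldl_update_of_mem {c : I → M} (hc : Function.Injective c) (v : I → ZMod 2) (l : List I)
    (m : M → ZMod 2) {i : I} (hi : i ∈ l) :
    l.foldl (fun m' i => Function.update m' (c i) (v i)) m (c i) = v i := by
  induction l using List.reverseRecOn with
  | nil => simp at hi
  | append_singleton l j ih =>
    rw [List.foldl_append, List.foldl_cons, List.foldl_nil]
    by_cases hij : i = j
    · simp [hij]
    · rw [Function.update_of_ne (fun h => hij (hc h))]
      exact ih (by simpa [hij] using hi)

end Cells

/-! ### Layers of gates on a part of the qubits -/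

section Layers

variable {A B : Type} [Fintype B] [DecidableEq A] [DecidableEq B]

/-- Formulated for partial lists so that induction applies: a qubit not yet treated contributes a
delta factor to the kernel. -/
theorem foldl_apply₁_inl (V : B → Matrix.unitaryGroup (ZMod 2) ℂ) {l : List B} (hl : l.Nodup)
    (ψ : QState (B ⊕ A)) (u : B ⊕ A → ZMod 2) :
    l.foldl (fun φ b => apply₁ (V b) (Sum.inl b) φ) ψ u =
      ∑ v : B → ZMod 2, (∏ b, if b ∈ l then (V b).1 (u (Sum.inl b)) (v b)
        else if u (Sum.inl b) = v b then 1 else 0) * ψ (Sum.elim v (u ∘ Sum.inr)) := by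
  induction l using List.reverseRecOn generalizing u with
  | nil =>
    simp only [List.foldl_nil, List.not_mem_nil, if_false]
    rw [Finset.sum_eq_single (u ∘ Sum.inl)]
    · simp
    · intro v _ hv
      obtain ⟨b, hb⟩ := Function.ne_iff.1 hv
      rw [Finset.prod_eq_zero (Finset.mem_univ b), zero_mul]
      exact if_neg fun h => hb h.symm
    · simp
  | append_singleton l b ih =>
    have hl' := List.nodup_append.1 hl
    have hb : b ∉ l := fun h => hl'.2.2 b h b (by simp) rfl
    rw [List.foldl_append, List.foldl_cons, List.foldl_nil, apply₁]
    simp only [ih hl'.1, Finset.mul_sum]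
    rw [Finset.sum_comm]
    refine Finset.sum_congr rfl fun v _ => ?_
    have hr : ∀ β, Function.update u (Sum.inl b) β ∘ Sum.inr = u ∘ Sum.inr := fun β => by
      funext a; simp
    simp only [hr, ← mul_assoc, ← Finset.sum_mul]
    congr 1
    -- Since `b ∉ l`, its factor is a delta in `β`, which collapses the sum over `β`; the other
    -- factors do not see the update.
    have key : ∀ β, (∏ b', if b' ∈ l then
          (V b').1 (Function.update u (Sum.inl b) β (Sum.inl b')) (v b')
          else if Function.update u (Sum.inl b) β (Sum.inl b') = v b' then (1 : ℂ) else 0) =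
        (if β = v b then 1 else 0) * ∏ b' ∈ Finset.univ.erase b,
          (if b' ∈ l then (V b').1 (u (Sum.inl b')) (v b')
          else if u (Sum.inl b') = v b' then 1 else 0) := by
      intro β
      rw [← Finset.mul_prod_erase _ _ (Finset.mem_univ b)]
      congr 1
      · simp [hb]
      · refine Finset.prod_congr rfl fun b' hb' => ?_
        have : (Sum.inl b' : B ⊕ A) ≠ Sum.inl b := by simpa using hb'
        simp [Function.update_of_ne this]
    simp only [key]
    rw [← Finset.mul_prod_erase _ _ (Finset.mem_univ b)]
    simp only [← mul_assoc, ← Finset.sum_mul]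
    congr 1
    · simp
    · refine Finset.prod_congr rfl fun b' hb' => ?_
      have : b' ≠ b := by simpa using hb'
      simp [this]

/-- The effect of a single-qubit gate on each qubit of the first kind. -/
theorem foldl_univ_apply₁_inl (V : B → Matrix.unitaryGroup (ZMod 2) ℂ) (ψ : QState (B ⊕ A))
    (u : B ⊕ A → ZMod 2) :
    Finset.univ.toList.foldl (fun φ b => apply₁ (V b) (Sum.inl b) φ) ψ u =
      ∑ v : B → ZMod 2, (∏ b, (V b).1 (u (Sum.inl b)) (v b)) *
        ψ (Sum.elim v (u ∘ Sum.inr)) := by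
  rw [foldl_apply₁_inl V (Finset.nodup_toList _)]
  simp

/-- The effect of a monomial single-qubit gate on each qubit of the first kind. -/
theorem foldl_univ_apply₁_inl_monomial (V : B → Matrix.unitaryGroup (ZMod 2) ℂ)
    (t : B → ZMod 2) (d : B → ZMod 2 → ℂ)
    (hV : ∀ b i j, (V b).1 i j = if j = i + t b then d b i else 0) (ψ : QState (B ⊕ A))
    (u : B ⊕ A → ZMod 2) :
    Finset.univ.toList.foldl (fun φ b => apply₁ (V b) (Sum.inl b) φ) ψ u =
      (∏ b, d b (u (Sum.inl b))) * ψ (Sum.elim (u ∘ Sum.inl + t) (u ∘ Sum.inr)) := by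
  rw [foldl_univ_apply₁_inl, Finset.sum_eq_single (u ∘ Sum.inl + t)]
  · simp [hV]
  · intro v _ hv
    obtain ⟨b, hb⟩ := Function.ne_iff.1 hv
    rw [Finset.prod_eq_zero (Finset.mem_univ b), zero_mul]
    rw [hV, if_neg]
    simpa using hb
  · simp

end Layers

/-! ### The gates -/

/-- The nontrivial character of `𝔽₂`. -/
def sgn (b : ZMod 2) : ℝ := if b = 0 then 1 else -1

theorem sgn_zero : sgn 0 = 1 := rfl

theorem sgn_one : sgn 1 = -1 := by simp [sgn]

theorem sgn_add (a b : ZMod 2) : sgn (a + b) = sgn a * sgn b := by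
  obtain rfl | rfl := eq_zero_or_one a <;> obtain rfl | rfl := eq_zero_or_one b <;>
    simp [sgn, CharTwo.add_self_eq_zero]

theorem sgn_sum {α : Type*} (s : Finset α) (f : α → ZMod 2) :
    sgn (∑ a ∈ s, f a) = ∏ a ∈ s, sgn (f a) := by
  classical
  induction s using Finset.induction_on with
  | empty => simp [sgn_zero]
  | insert a s ha ih => rw [Finset.sum_insert ha, Finset.prod_insert ha, sgn_add, ih]

theorem map_perm_mem_unitaryGroup {n : Type} [Fintype n] [DecidableEq n] {f : n → n}
    (hf : Function.Injective f) :
    (Matrix.of fun i j => if j = f i then (1 : ℂ) else 0) ∈ Matrix.unitaryGroup n ℂ := by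
  rw [Matrix.mem_unitaryGroup_iff]
  ext i j
  simp [Matrix.mul_apply, Matrix.star_apply, Matrix.one_apply, apply_ite, hf.eq_iff, eq_comm]

/-- The Hadamard gate. -/
noncomputable def hadamardGate : Matrix.unitaryGroup (ZMod 2) ℂ :=
  ⟨Matrix.of fun i j => ((√2)⁻¹ : ℝ) * (sgn (i * j) : ℝ), by
    rw [Matrix.mem_unitaryGroup_iff]
    have h : ((√2)⁻¹ : ℂ) * (√2 : ℂ)⁻¹ = 1 / 2 := by
      rw [← mul_inv, ← Complex.ofReal_mul, Real.mul_self_sqrt (by norm_num)]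
      norm_num
    have h2 : (Finset.univ : Finset (ZMod 2)) = {0, 1} := rfl
    ext i j
    obtain rfl | rfl := eq_zero_or_one i <;> obtain rfl | rfl := eq_zero_or_one j <;>
      simp [Matrix.mul_apply, h2, Matrix.star_apply, sgn, h] <;>
      norm_num⟩

/-- The `X` gate. -/
noncomputable def flipGate : Matrix.unitaryGroup (ZMod 2) ℂ :=
  ⟨_, map_perm_mem_unitaryGroup (add_left_injective (1 : ZMod 2))⟩

/-- The gate that adds the value of the first qubit to the second one. -/
noncomputable def cnotGate : Matrix.unitaryGroup (ZMod 2 × ZMod 2) ℂ :=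
  ⟨_, map_perm_mem_unitaryGroup (f := fun x : ZMod 2 × ZMod 2 => (x.1, x.2 + x.1))
    (by decide)⟩

/-- The rotation that multiplies the basis vector `|b⟩` by `exp (i (-1)ᵇ θ)`. -/
noncomputable def phaseGate (θ : ℝ) : Matrix.unitaryGroup (ZMod 2) ℂ :=
  ⟨Matrix.diagonal fun b => Complex.exp (((θ * sgn b : ℝ) : ℂ) * Complex.I), by
    rw [Matrix.mem_unitaryGroup_iff, Matrix.star_eq_conjTranspose, Matrix.diagonal_conjTranspose,
      Matrix.diagonal_mul_diagonal, ← Matrix.diagonal_one]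
    congr 1
    funext b
    simp only [Pi.star_apply, RCLike.star_def]
    rw [Complex.mul_conj, Complex.normSq_eq_norm_sq, Complex.norm_exp_ofReal_mul_I]
    simp⟩

theorem apply₂_cnotGate {Q : Type} [DecidableEq Q] (q r : Q) (ψ : QState Q)
    (u : Q → ZMod 2) :
    apply₂ cnotGate q r ψ u = ψ (Function.update u r (u r + u q)) := by
  simp only [apply₂, cnotGate, Matrix.of_apply, ite_mul, one_mul, zero_mul]
  rw [Finset.sum_ite_eq' Finset.univ]
  simp

/-! ### Layers of controlled additions -/

section Cnot

variable {ι A B M : Type}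

/-- The layer that adds the value of the qubit `b` to the qubit `a` whenever `π a = some b`. -/
noncomputable def cnotLayer (π : A → Option B) (l : List A) : List (Op ι (B ⊕ A) M) :=
  l.filterMap fun a => (π a).map fun b =>
    Op.gate₂ none cnotGate (Sum.inl b) (Sum.inr a) Sum.inl_ne_inr

theorem cnotLayer_pairwise {π : A → Option B} (hπ : ∀ a a' b, π a = some b → π a' = some b → a = a')
    {l : List A} (hl : l.Nodup) :
    (cnotLayer π l : List (Op ι (B ⊕ A) M)).Pairwise Op.Compatible := by
  refine List.Pairwise.filterMap _ (R := (· ≠ ·)) (fun a a' haa' o ho o' ho' => ?_) hl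
  obtain ⟨b, hb, rfl⟩ := Option.map_eq_some_iff.1 ho
  obtain ⟨b', hb', rfl⟩ := Option.map_eq_some_iff.1 ho'
  have hbb' : b ≠ b' := fun h => haa' (hπ a a' b hb (h ▸ hb'))
  simp [Op.Compatible, Op.qubits, Op.cells, haa', hbb', eq_comm]

variable [DecidableEq A] [DecidableEq B]

/-- Controls and targets are of different kinds, so no control value changes and the additions do
not interfere. -/
theorem runLayer_cnotLayer [DecidableEq M] (y : ι → ZMod 2) (π : A → Option B) {l : List A}
    (hl : l.Nodup) (m : M → ZMod 2) (ψ : QState (B ⊕ A)) :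
    runLayer y (cnotLayer π l) (m, ψ) =
      [(m, fun u => ψ (Sum.elim (u ∘ Sum.inl) fun a =>
        u (Sum.inr a) + if a ∈ l then (π a).elim 0 (u ∘ Sum.inl) else 0))] := by
  unfold runLayer cnotLayer
  induction l generalizing ψ with
  | nil =>
    simp only [List.filterMap_nil, List.foldl_nil, List.not_mem_nil, if_false, add_zero]
    congr 2
    funext u
    congr 1
    funext i
    cases i <;> rfl
  | cons a l ih =>
    obtain ⟨ha, hl⟩ := List.nodup_cons.1 hl
    cases hπ : π a with
    | none =>
      rw [List.filterMap_cons_none (by simp [hπ]), ih hl]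
      congr 2
      funext u
      congr 2
      funext a'
      by_cases h : a' = a <;> simp [h, hπ]
    | some b =>
      rw [List.filterMap_cons_some (by simp [hπ]; rfl), List.foldl_cons]
      have hrun : (Op.gate₂ none cnotGate (Sum.inl b) (Sum.inr a) Sum.inl_ne_inr).run
          (Sum.elim y m) (m, ψ) = [(m, apply₂ cnotGate (Sum.inl b) (Sum.inr a) ψ)] := by
        simp [Op.run, Active]
      simp only [List.flatMap_cons, List.flatMap_nil, List.append_nil, hrun]
      rw [ih hl]
      congr 2
      funext u
      rw [apply₂_cnotGate]
      congr 1
      funext i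
      rcases i with b' | a'
      · simp
      · by_cases h : a' = a
        · subst h
          simp [ha, hπ]
        · simp [h]

theorem runLayer_cnotLayer_univ [Fintype A] [DecidableEq M] (y : ι → ZMod 2) (π : A → Option B)
    (m : M → ZMod 2) (ψ : QState (B ⊕ A)) :
    runLayer y (cnotLayer π Finset.univ.toList) (m, ψ) =
      [(m, fun u => ψ (Sum.elim (u ∘ Sum.inl) fun a =>
        u (Sum.inr a) + (π a).elim 0 (u ∘ Sum.inl)))] := by
  rw [runLayer_cnotLayer y π (Finset.nodup_toList _)]
  simp

end Cnot

/-! ### The circuit of a sparse code -/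

/-- The data of a circuit that prepares the uniform superposition of a code in `B → ZMod 2`, given
by parity checks labelled by `A`, each of which involves at most three bits, and each bit being
in at most three checks; it then applies phases to the bits and measures them in the Hadamard
basis. -/
structure Scheme (ι κ A B : Type) where
  /-- The bits in a check. -/
  chk : Fin 3 → A → Option B
  -- This makes the CNOT gates of one layer act on disjoint pairs of qubits.
  chk_inj : ∀ r a a' b, chk r a = some b → chk r a' = some b → a = a'
  /-- The parities of the syndrome that correct the state. -/
  corr : B → Finset A
  /-- The input bits that control the phases. -/
  ctrl : B → ι
  angle : B → ℝ
  /-- The parities of the measured values that are the output. -/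
  out : κ → Finset B

namespace Scheme

variable {ι κ A B : Type}

/-- The syndrome of a word. -/
def syndrome (D : Scheme ι κ A B) (v : B → ZMod 2) (a : A) : ZMod 2 :=
  ∑ r, (D.chk r a).elim 0 v

/-- The correction that belongs to a syndrome. -/
def correction (D : Scheme ι κ A B) (w : A → ZMod 2) (b : B) : ZMod 2 := ∑ a ∈ D.corr b, w a

/-- The output that belongs to a measured word. -/
def output (D : Scheme ι κ A B) (v : B → ZMod 2) (j : κ) : ZMod 2 := ∑ b ∈ D.out j, v b

/-- The phase that a word obtains. -/
noncomputable def phase [Fintype B] (D : Scheme ι κ A B) (y : ι → ZMod 2) (v : B → ZMod 2) : ℂ :=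
  ∏ b, if y (D.ctrl b) = 1 then Complex.exp (((D.angle b * sgn (v b) : ℝ) : ℂ) * Complex.I) else 1

/-- The classical cells: syndrome, correction, measured values and output. -/
abbrev Memory (κ A B : Type) : Type := (A ⊕ B) ⊕ (B ⊕ κ)

/-- The wires that carry the syndrome. -/
def syndromeWire : A ↪ ι ⊕ Memory κ A B :=
  ⟨fun a => Sum.inr (Sum.inl (Sum.inl a)), fun _ _ h => by simpa using h⟩

/-- The wires that carry the measured values. -/
def resultWire : B ↪ ι ⊕ Memory κ A B :=
  ⟨fun b => Sum.inr (Sum.inr (Sum.inl b)), fun _ _ h => by simpa using h⟩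

theorem elim_syndromeWire (y : ι → ZMod 2) (m : Memory κ A B → ZMod 2) (a : A) :
    Sum.elim y m (syndromeWire a) = m (Sum.inl (Sum.inl a)) := rfl

theorem elim_resultWire (y : ι → ZMod 2) (m : Memory κ A B → ZMod 2) (b : B) :
    Sum.elim y m (resultWire b) = m (Sum.inr (Sum.inl b)) := rfl

theorem value_cnotLayers {M : Type} [Fintype A] [DecidableEq A] [DecidableEq B] [DecidableEq M]
    (D : Scheme ι κ A B) (y : ι → ZMod 2)
    (f : Branch (B ⊕ A) M → ℝ) (Ls : List (List (Op ι (B ⊕ A) M))) (m : M → ZMod 2)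
    (ψ : QState (B ⊕ A)) :
    value y f (cnotLayer (D.chk 0) Finset.univ.toList :: cnotLayer (D.chk 1) Finset.univ.toList ::
      cnotLayer (D.chk 2) Finset.univ.toList :: Ls) (m, ψ) =
    value y f Ls (m, fun u =>
      ψ (Sum.elim (u ∘ Sum.inl) (u ∘ Sum.inr + D.syndrome (u ∘ Sum.inl)))) := by
  rw [value_cons_of_eq_singleton (runLayer_cnotLayer_univ _ _ _ _),
    value_cons_of_eq_singleton (runLayer_cnotLayer_univ _ _ _ _),
    value_cons_of_eq_singleton (runLayer_cnotLayer_univ _ _ _ _)]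
  congr 2
  funext u
  congr 2
  funext a
  simp only [syndrome, Fin.sum_univ_three, Function.comp_def, Sum.elim_inl, Sum.elim_inr,
    Pi.add_apply]
  ring

variable [Fintype A] [Fintype B] [Fintype κ]
  [DecidableEq A] [DecidableEq B] [DecidableEq κ] (D : Scheme ι κ A B)

/-- The layers from the correction on. -/
noncomputable def lateLayers : List (List (Op ι (B ⊕ A) (Memory κ A B))) :=
  [Finset.univ.toList.map fun b => Op.parity ((D.corr b).map
      syndromeWire) (Sum.inl (Sum.inr b)),
    Finset.univ.toList.map fun b =>
      Op.gate₁ (some (Sum.inr (Sum.inl (Sum.inr b)))) flipGate (Sum.inl b),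
    Finset.univ.toList.map fun b =>
      Op.gate₁ (some (Sum.inl (D.ctrl b))) (phaseGate (D.angle b)) (Sum.inl b),
    Finset.univ.toList.map fun b => Op.gate₁ none hadamardGate (Sum.inl b),
    Finset.univ.toList.map fun b => Op.measure (Sum.inl b) (Sum.inr (Sum.inl b)),
    Finset.univ.toList.map fun j => Op.parity ((D.out j).map
      resultWire) (Sum.inr (Sum.inr j))]

/-- All layers. -/
noncomputable def layers : List (List (Op ι (B ⊕ A) (Memory κ A B))) :=
  (Finset.univ.toList.map fun b => Op.gate₁ none hadamardGate (Sum.inl b)) ::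
    cnotLayer (D.chk 0) Finset.univ.toList :: cnotLayer (D.chk 1) Finset.univ.toList ::
    cnotLayer (D.chk 2) Finset.univ.toList ::
    (Finset.univ.toList.map fun a => Op.measure (Sum.inr a) (Sum.inl (Sum.inl a))) ::
    D.lateLayers

theorem pairwise_map_toList {I : Type} [Fintype I] {Q M : Type} (f : I → Op ι Q M)
    (hf : ∀ i j, i ≠ j → (f i).Compatible (f j)) :
    (Finset.univ.toList.map f).Pairwise Op.Compatible :=
  List.Pairwise.map f (fun i j h => hf i j h) (Finset.nodup_toList _)

/-- The circuit of a scheme. -/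
noncomputable def circuit : Circuit ι κ where
  Qubit := B ⊕ A
  Cell := Memory κ A B
  layers := D.layers
  compatible := by
    intro L hL
    simp only [layers, lateLayers, List.mem_cons, List.not_mem_nil, or_false] at hL
    rcases hL with rfl | rfl | rfl | rfl | rfl | rfl | rfl | rfl | rfl | rfl | rfl
    case inr.inl => exact cnotLayer_pairwise (D.chk_inj 0) (Finset.nodup_toList _)
    case inr.inr.inl => exact cnotLayer_pairwise (D.chk_inj 1) (Finset.nodup_toList _)
    case inr.inr.inr.inl => exact cnotLayer_pairwise (D.chk_inj 2) (Finset.nodup_toList _)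
    all_goals
      refine pairwise_map_toList _ fun i j hij => ?_
      simp [Op.Compatible, Op.qubits, Op.cells, hij]
  out := fun j => Sum.inr (Sum.inr (Sum.inr j))

theorem depth_circuit : D.circuit.depth = 11 := rfl

theorem size_circuit_le :
    D.circuit.size ≤ 9 * Fintype.card B + 6 * Fintype.card A + 2 * Fintype.card κ := by
  have h : ∀ r, (cnotLayer (D.chk r) Finset.univ.toList :
      List (Op ι (B ⊕ A) (Memory κ A B))).length ≤ Fintype.card A := fun r =>
    (List.length_filterMap_le _ _).trans (by simp)
  have h0 := h 0
  have h1 := h 1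
  have h2 := h 2
  have hQ : Fintype.card D.circuit.Qubit = Fintype.card B + Fintype.card A := Fintype.card_sum
  have hM : Fintype.card D.circuit.Cell =
      Fintype.card A + Fintype.card B + (Fintype.card B + Fintype.card κ) :=
    Fintype.card_sum.trans (by rw [Fintype.card_sum, Fintype.card_sum])
  rw [Circuit.size, hQ, hM]
  simp only [circuit, layers, lateLayers, List.map_cons, List.map_nil,
    List.sum_cons, List.sum_nil, List.length_map, Finset.length_toList, Finset.card_univ]
  omega

/-! ### The output distribution -/

/-- The amplitude of `u` after the last layer of gates, if `ψ` is the state before the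
correction, and `t` the correction. -/
noncomputable def lateAmplitude (y : ι → ZMod 2) (t : B → ZMod 2) (u : B ⊕ A → ZMod 2)
    (ψ : QState (B ⊕ A)) : ℂ :=
  ∑ v : B → ZMod 2, (∏ b, (((√2)⁻¹ : ℝ) * (sgn (u (Sum.inl b) * v b) : ℝ) : ℂ)) *
    (D.phase y v * ψ (Sum.elim (v + t) (u ∘ Sum.inr)))

open Classical in
/-- The contribution of `u` to the probability of the output `x`. -/
noncomputable def contribution (y : ι → ZMod 2) (x : κ → ZMod 2) (t : B → ZMod 2)
    (u : B ⊕ A → ZMod 2) (ψ : QState (B ⊕ A)) : ℝ :=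
  if D.output (u ∘ Sum.inl) = x then ‖D.lateAmplitude y t u ψ‖ ^ 2 else 0

-- The branches of the final measurement turn into a sum over basis vectors `u`; the earlier
-- syndrome enters only through the correction.
open Classical in
theorem value_lateLayers (y : ι → ZMod 2) (x : κ → ZMod 2) :
    value y (fun B' : Branch (B ⊕ A) (Memory κ A B) =>
        if (fun j => Sum.elim y B'.1 (Sum.inr (Sum.inr (Sum.inr j)))) = x then weight B'.2 else 0)
      D.lateLayers =
    fun B' => ∑ u, D.contribution y x (D.correction fun a => B'.1 (Sum.inl (Sum.inl a))) u B'.2 := by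
  funext ⟨m, ψ⟩
  unfold lateLayers
  rw [value_cons_of_eq_singleton (runLayer_parity _ _ _ _ _ _)]
  set t := D.correction fun a => m (Sum.inl (Sum.inl a)) with ht
  set m₁ : Memory κ A B → ZMod 2 := List.foldl _ m _ with hm₁
  have hm₁c : ∀ b, m₁ (Sum.inl (Sum.inr b)) = t b := by
    intro b
    rw [hm₁, foldl_update_of_mem (c := fun b : B => (Sum.inl (Sum.inr b) : Memory κ A B))
      (fun _ _ h => by simpa using h) _ _ _ (by simp)]
    simp [t, correction, elim_syndromeWire]
  clear_value m₁
  rw [value_cons_of_eq_singleton (runLayer_gate₁ _ _ _ _ _ _ _),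
    value_cons_of_eq_singleton (runLayer_gate₁ _ _ _ _ _ _ _),
    value_cons_of_eq_singleton (runLayer_gate₁ _ _ _ _ _ _ _)]
  set χ : QState (B ⊕ A) := List.foldl _ _ _ with hχ
  have hχu : ∀ u, χ u = D.lateAmplitude y t u ψ := by
    intro u
    rw [hχ, foldl_univ_apply₁_inl]
    unfold lateAmplitude
    refine Finset.sum_congr rfl fun v _ => ?_
    congr 1
    · simp [controlled, Active, hadamardGate]
    -- The phase layer is diagonal and the correction layer is a pure shift by `t`, so neither
    -- produces a sum over words.
    · rw [foldl_univ_apply₁_inl_monomial (t := 0) (d := fun b i => if y (D.ctrl b) = 1 then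
        Complex.exp (((D.angle b * sgn i : ℝ) : ℂ) * Complex.I) else 1)]
      · rw [foldl_univ_apply₁_inl_monomial (t := t) (d := fun _ _ => 1)]
        · simp [phase]
        · intro b i j
          obtain h | h := eq_zero_or_one (t b) <;>
            simp [controlled, Active, hm₁c, h, flipGate, Matrix.one_apply, eq_comm]
      · intro b i j
        by_cases h : y (D.ctrl b) = 1 <;>
          simp [controlled, Active, h, phaseGate, Matrix.one_apply, Matrix.diagonal_apply, eq_comm]
  clear_value χ
  have hlast :
      value y (fun B' : Branch (B ⊕ A) (Memory κ A B) =>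
        if (fun j => Sum.elim y B'.1 (Sum.inr (Sum.inr (Sum.inr j)))) = x then weight B'.2 else 0)
        [Finset.univ.toList.map fun j => Op.parity ((D.out j).map
          resultWire) (Sum.inr (Sum.inr j))] =
      fun B' => ∑ u, if D.output (fun b => B'.1 (Sum.inr (Sum.inl b))) = x then ‖B'.2 u‖ ^ 2 else 0 := by
    funext ⟨m', φ⟩
    rw [value_cons_of_eq_singleton (runLayer_parity _ _ _ _ _ _)]
    simp only [value, Sum.elim_inr, weight]
    have : ∀ j : κ, Finset.univ.toList.foldl (fun m'' (j : κ) => Function.update m''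
        (Sum.inr (Sum.inr j) : Memory κ A B) (∑ v ∈ (D.out j).map
          resultWire, Sum.elim y m' v)) m' (Sum.inr (Sum.inr j)) =
        D.output (fun b => m' (Sum.inr (Sum.inl b))) j := by
      intro j
      rw [foldl_update_of_mem (c := fun j : κ => (Sum.inr (Sum.inr j) : Memory κ A B))
        (fun _ _ h => by simpa using h) _ _ _ (by simp)]
      simp [output, elim_resultWire]
    simp only [this]
    split_ifs <;> simp
  rw [value, hlast]
  rw [sum_runLayer_measure y (fun b : B => (Sum.inl b : B ⊕ A))
    (fun b => (Sum.inr (Sum.inl b) : Memory κ A B))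
    (fun m' u φ => if D.output (fun b => m' (Sum.inr (Sum.inl b))) = x then ‖φ u‖ ^ 2 else 0)]
  · refine Finset.sum_congr rfl fun u _ => ?_
    have : (fun b => Finset.univ.toList.foldl (fun m' (b : B) => Function.update m'
        (Sum.inr (Sum.inl b) : Memory κ A B) (u (Sum.inl b))) m₁ (Sum.inr (Sum.inl b))) =
        u ∘ Sum.inl := by
      funext b
      exact foldl_update_of_mem (c := fun b : B => (Sum.inr (Sum.inl b) : Memory κ A B))
        (fun _ _ h => by simpa using h) (fun b => u (Sum.inl b)) _ _ (by simp)
    simp only [this, hχu, contribution]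
  · intro m' u φ b β
    by_cases h : u (Sum.inl b) = β <;> simp [proj, h]

theorem foldl_hadamard_zeroState (U : Matrix.unitaryGroup (ZMod 2) ℂ) (hU : U = hadamardGate)
    (u : B ⊕ A → ZMod 2) :
    Finset.univ.toList.foldl (fun φ b => apply₁ U (Sum.inl b) φ) zeroState u =
      ((√2)⁻¹ : ℂ) ^ Fintype.card B * if u ∘ Sum.inr = 0 then 1 else 0 := by
  subst hU
  rw [foldl_univ_apply₁_inl, Finset.sum_eq_single 0]
  · congr 1
    · simp [hadamardGate, sgn_zero]
    · unfold zeroState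
      refine if_congr ?_ rfl rfl
      rw [← Sum.elim_zero_zero, Sum.elim_eq_iff]
      simp
  · intro v _ hv
    unfold zeroState
    rw [if_neg, mul_zero]
    rw [← Sum.elim_zero_zero, Sum.elim_eq_iff]
    exact fun h => hv h.1
  · simp

/-- The probability of an output in terms of sums over the words with given syndrome. -/
theorem prob_circuit (y : ι → ZMod 2) (x : κ → ZMod 2) :
    D.circuit.prob y x = ∑ u : B ⊕ A → ZMod 2,
      D.contribution y x (D.correction (u ∘ Sum.inr)) u fun u' =>
        ((√2)⁻¹ : ℂ) ^ Fintype.card B *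
          if D.syndrome (u' ∘ Sum.inl) = u' ∘ Sum.inr then 1 else 0 := by
  classical
  have h := sum_foldl_runLayer y (fun B' : Branch (B ⊕ A) (Memory κ A B) =>
        if (fun j => Sum.elim y B'.1 (Sum.inr (Sum.inr (Sum.inr j)))) = x then weight B'.2 else 0)
        D.layers [(0, zeroState)]
  have h' : D.circuit.prob y x = value y (fun B' : Branch (B ⊕ A) (Memory κ A B) =>
        if (fun j => Sum.elim y B'.1 (Sum.inr (Sum.inr (Sum.inr j)))) = x then weight B'.2 else 0)
        D.layers (0, zeroState) := by
    rw [List.map_singleton, List.sum_singleton] at h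
    rw [← h]
    unfold Circuit.prob Circuit.branches circuit
    congr!
  rw [h']
  unfold layers
  set χ : QState (B ⊕ A) := fun u' => ((√2)⁻¹ : ℂ) ^ Fintype.card B *
          if D.syndrome (u' ∘ Sum.inl) = u' ∘ Sum.inr then 1 else 0 with hχ
  rw [value_cons_of_eq_singleton (runLayer_gate₁ _ _ _ _ _ _ _)]
  have hψ := foldl_hadamard_zeroState (A := A) (B := B) (controlled (Sum.elim y
    (0 : Memory κ A B → ZMod 2)) none hadamardGate) (by simp [controlled, Active])
  generalize List.foldl _ (zeroState : QState (B ⊕ A)) _ = ψ at hψ ⊢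
  rw [value_cnotLayers, value]
  -- The check qubits started at `0`, so after the additions exactly the pairs of a word and its
  -- syndrome survive.
  have hχψ : (fun u => ψ (Sum.elim (u ∘ Sum.inl) (u ∘ Sum.inr + D.syndrome (u ∘ Sum.inl)))) = χ := by
    funext u
    rw [hψ, hχ]
    refine congrArg (((√2)⁻¹ : ℂ) ^ Fintype.card B * ·) (if_congr ?_ rfl rfl)
    rw [Sum.elim_comp_inr, add_eq_zero_iff_eq, eq_comm]
  rw [hχψ, value_lateLayers, sum_runLayer_measure y (fun a : A => (Sum.inr a : B ⊕ A))
    (fun a => (Sum.inl (Sum.inl a) : Memory κ A B))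
    (fun m' u φ => D.contribution y x (D.correction fun a => m' (Sum.inl (Sum.inl a))) u φ)]
  · refine Finset.sum_congr rfl fun u _ => ?_
    refine congrArg (fun w => D.contribution y x (D.correction w) u χ) (funext fun a => ?_)
    exact foldl_update_of_mem (c := fun a : A => (Sum.inl (Sum.inl a) : Memory κ A B))
        (fun _ _ h => by simpa using h) (fun a => u (Sum.inr a)) _ _ (by simp)
  -- The amplitude at `u` only involves basis vectors with the same check qubits as `u`.
  · intro m' u φ a β
    by_cases h : u (Sum.inr a) = β <;> simp [contribution, lateAmplitude, proj, h]

end Scheme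
/-! ### Schemes that prepare a given code -/

/-- A linear map over `𝔽₂` is computed by one parity gate per output coordinate, over the columns
with entry `1`. -/
theorem sum_filter_map_single {α β : Type*} [Fintype α] [DecidableEq α]
    (f : (α → ZMod 2) →ₗ[ZMod 2] (β → ZMod 2)) (w : α → ZMod 2) (b : β) :
    ∑ a with f (Pi.single a 1) b = 1, w a = f w b := by
  rw [LinearMap.pi_apply_eq_sum_univ f w, Finset.sum_filter, Finset.sum_apply]
  refine Finset.sum_congr rfl fun a _ => ?_
  have : (fun j => if a = j then (1 : ZMod 2) else 0) = Pi.single a 1 := by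
    funext j
    simp [Pi.single_apply, eq_comm]
  rw [this]
  obtain h | h := eq_zero_or_one (f (Pi.single a 1) b) <;> simp [h]

/-- The fibres of a surjective additive map between spaces over `𝔽₂` have equal size. -/
theorem card_fiber_mul {α β : Type*} [Fintype α] [Fintype β] [DecidableEq α] [DecidableEq β]
    (f : (α → ZMod 2) → β → ZMod 2) (hadd : ∀ v v', f (v + v') = f v + f v')
    (hf : Function.Surjective f) (x : β → ZMod 2) :
    (Finset.univ.filter fun v => f v = x).card * 2 ^ Fintype.card β = 2 ^ Fintype.card α := by
  have hconst : ∀ x', (Finset.univ.filter fun v => f v = x').card =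
      (Finset.univ.filter fun v => f v = x).card := by
    intro x'
    obtain ⟨d, hd⟩ := hf (x - x')
    refine Finset.card_equiv (Equiv.addRight d) fun v => ?_
    simp only [Finset.mem_filter, Finset.mem_univ, true_and, Equiv.coe_addRight, hadd, hd]
    constructor
    · rintro rfl
      simp
    · intro h
      simpa using congrArg (· - (x - x')) h
  have h := Finset.card_eq_sum_card_fiberwise (f := f) (s := Finset.univ) (t := Finset.univ)
    (fun _ _ => Finset.mem_coe.2 (Finset.mem_univ _))
  simp only [hconst, Finset.sum_const, Finset.card_univ, Fintype.card_fun, ZMod.card,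
    smul_eq_mul] at h
  rw [h, mul_comm]

namespace Scheme

variable {ι κ A B : Type} (D : Scheme ι κ A B)

theorem syndrome_add (v v' : B → ZMod 2) : D.syndrome (v + v') = D.syndrome v + D.syndrome v' := by
  funext a
  simp only [syndrome, Pi.add_apply, ← Finset.sum_add_distrib]
  refine Finset.sum_congr rfl fun r _ => ?_
  cases D.chk r a <;> simp

theorem output_add (v v' : B → ZMod 2) : D.output (v + v') = D.output v + D.output v' := by
  funext j
  simp [output, Finset.sum_add_distrib]

variable [Fintype A] [Fintype B] [Fintype κ] [DecidableEq A] [DecidableEq B] [DecidableEq κ]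

/-- The output distribution of a scheme that prepares the code with the encoding map `enc`. -/
theorem prob_circuit_of_encoding (hcorr : ∀ w, D.syndrome (D.correction w) = w)
    (hsurj : Function.Surjective D.output) (hcard : Fintype.card B = Fintype.card A + Fintype.card κ)
    (enc : (κ → ZMod 2) → B → ZMod 2) (henc : Function.Injective enc)
    (hker : ∀ v, D.syndrome v = 0 ↔ ∃ z, enc z = v)
    (hdual : ∀ v z, ∑ b, v b * enc z b = ∑ j, D.output v j * z j)
    (y : ι → ZMod 2) (x : κ → ZMod 2) :
    D.circuit.prob y x =
      (‖∑ z : κ → ZMod 2, (sgn (∑ j, x j * z j) : ℂ) * D.phase y (enc z)‖ /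
        2 ^ Fintype.card κ) ^ 2 := by
  classical
  set S : ℂ := ∑ z : κ → ZMod 2, (sgn (∑ j, x j * z j) : ℂ) * D.phase y (enc z) with hS
  have hsq : (√2 : ℂ) * √2 = 2 := by
    rw [← Complex.ofReal_mul, Real.mul_self_sqrt (by norm_num)]
    norm_num
  have hamp : ∀ u : B ⊕ A → ZMod 2, D.output (u ∘ Sum.inl) = x →
      D.lateAmplitude y (D.correction (u ∘ Sum.inr)) u (fun u' =>
        ((√2)⁻¹ : ℂ) ^ Fintype.card B *
          if D.syndrome (u' ∘ Sum.inl) = u' ∘ Sum.inr then 1 else 0) =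
        (2⁻¹ : ℂ) ^ Fintype.card B * S := by
    intro u hu
    have hprod : ∀ v : B → ZMod 2,
        (∏ b, (((√2)⁻¹ : ℝ) * (sgn (u (Sum.inl b) * v b) : ℝ) : ℂ)) =
          ((√2)⁻¹ : ℂ) ^ Fintype.card B * (sgn (∑ b, u (Sum.inl b) * v b) : ℂ) := by
      intro v
      rw [Finset.prod_mul_distrib, sgn_sum]
      simp
    -- The correction moves the coset of any syndrome to the code, so the amplitude does not depend
    -- on the syndrome.
    have hcond : ∀ v : B → ZMod 2,
        D.syndrome (Sum.elim (v + D.correction (u ∘ Sum.inr)) (u ∘ Sum.inr) ∘ Sum.inl) =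
          Sum.elim (v + D.correction (u ∘ Sum.inr)) (u ∘ Sum.inr) ∘ Sum.inr ↔
        D.syndrome v = 0 := by
      intro v
      rw [Sum.elim_comp_inl, Sum.elim_comp_inr, syndrome_add, hcorr]
      exact add_eq_right
    have hpow : ((√2)⁻¹ : ℂ) ^ Fintype.card B * ((√2)⁻¹ : ℂ) ^ Fintype.card B =
        (2⁻¹ : ℂ) ^ Fintype.card B := by
      rw [← mul_pow, ← mul_inv, hsq]
    have himage : (Finset.univ.filter fun v => D.syndrome v = 0) = Finset.univ.image enc := by
      ext v
      simp [hker]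
    unfold lateAmplitude
    simp only [hprod, hcond]
    rw [← hpow, hS, Finset.mul_sum]
    calc _ = ∑ v : B → ZMod 2, if D.syndrome v = 0 then
          ((√2)⁻¹ : ℂ) ^ Fintype.card B * ((√2)⁻¹ : ℂ) ^ Fintype.card B *
            ((sgn (∑ b, u (Sum.inl b) * v b) : ℂ) * D.phase y v) else 0 := by
          refine Finset.sum_congr rfl fun v _ => ?_
          split_ifs <;> ring
      _ = _ := by
          rw [← Finset.sum_filter, himage, Finset.sum_image henc.injOn]
          refine Finset.sum_congr rfl fun z _ => ?_
          rw [← hu, ← hdual]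
          rfl
  rw [prob_circuit]
  have hterm : ∀ u : B ⊕ A → ZMod 2,
      D.contribution y x (D.correction (u ∘ Sum.inr)) u (fun u' =>
        ((√2)⁻¹ : ℂ) ^ Fintype.card B *
          if D.syndrome (u' ∘ Sum.inl) = u' ∘ Sum.inr then 1 else 0) =
      if D.output (u ∘ Sum.inl) = x then ((2⁻¹ : ℝ) ^ Fintype.card B * ‖S‖) ^ 2 else 0 := by
    intro u
    unfold contribution
    by_cases hu : D.output (u ∘ Sum.inl) = x
    · rw [if_pos hu, if_pos hu, hamp u hu]
      simp
    · rw [if_neg hu, if_neg hu]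
  simp only [hterm]
  rw [← (Equiv.sumArrowEquivProdArrow B A (ZMod 2)).symm.sum_comp, Fintype.sum_prod_type]
  have hcomp : ∀ p : (B → ZMod 2) × (A → ZMod 2),
      (Equiv.sumArrowEquivProdArrow B A (ZMod 2)).symm p ∘ Sum.inl = p.1 := fun _ => rfl
  simp only [hcomp, Finset.sum_const, Finset.card_univ, Fintype.card_fun, ZMod.card, nsmul_eq_mul]
  rw [← Finset.mul_sum, ← Finset.sum_filter, Finset.sum_const, nsmul_eq_mul]
  have hcount := card_fiber_mul D.output D.output_add hsurj x
  have hcount' : ((Finset.univ.filter fun v => D.output v = x).card : ℝ) * 2 ^ Fintype.card κ =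
      2 ^ Fintype.card B := by
    exact_mod_cast hcount
  -- There are `2^|A|` measured words with output `x` and `2^|A|` syndromes, each pair contributing
  -- `4^(-|B|) ‖S‖²`; as `|B| = |A| + |κ|`, the total is `4^(-|κ|) ‖S‖²`.
  have hN : ((Finset.univ.filter fun v => D.output v = x).card : ℝ) = 2 ^ Fintype.card A := by
    rw [hcard, pow_add] at hcount'
    exact mul_right_cancel₀ (by positivity) hcount'
  rw [hN, hcard, pow_add, inv_pow, inv_pow]
  field_simp
  push_cast
  ring

end Scheme
/-! ### Sums over initial segments -/

section InitialSum

variable {R : Type*} [AddCommMonoid R] {n : ℕ}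

/-- The sum of the values of `f` before position `j`. -/
def initialSum (f : Fin n → R) (j : Fin (n + 1)) : R := ∑ i with i.castSucc < j, f i

theorem initialSum_zero (f : Fin n → R) : initialSum f 0 = 0 := by
  simp [initialSum]

theorem initialSum_succ (f : Fin n → R) (j : Fin n) :
    initialSum f j.succ = initialSum f j.castSucc + f j := by
  have : (Finset.univ.filter fun i : Fin n => i.castSucc < j.succ) =
      insert j (Finset.univ.filter fun i : Fin n => i.castSucc < j.castSucc) := by
    ext i
    simp [Fin.castSucc_lt_succ_iff, le_iff_eq_or_lt]
  rw [initialSum, this, Finset.sum_insert (by simp), add_comm, initialSum]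

theorem initialSum_last (f : Fin n → R) : initialSum f (Fin.last n) = ∑ i, f i := by
  simp [initialSum, Fin.castSucc_lt_last]

end InitialSum

/-! ### The code of partial parities -/

namespace PartialParity

variable {k M : ℕ}

/-- The bits of the code: copies `inl (i, p)` of the `i`-th message bit, and partial parities
`inr (p, j)`, for a family of linear forms labelled by `p`. -/
abbrev Bit (k M : ℕ) : Type := (Fin k × Fin (M + 1)) ⊕ (Fin (M + 1) × Fin (k + 1))

/-- The parity checks: equality of consecutive copies, and the recursion of partial parities. -/
abbrev Check (k M : ℕ) : Type := (Fin k × Fin M) ⊕ (Fin (M + 1) × Fin (k + 1))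

/-- The bits in the parity checks, for the linear forms with coefficients `s`. -/
def chk (s : Fin (M + 1) → Fin k → ZMod 2) : Fin 3 → Check k M → Option (Bit k M) :=
  ![Sum.elim (fun a => some (Sum.inl (a.1, a.2.castSucc))) (fun a => some (Sum.inr a)),
    Sum.elim (fun a => some (Sum.inl (a.1, a.2.succ)))
      -- The check at position `0` has no further bits: it makes the empty partial sum vanish.
      (fun a => Fin.cases none (fun j => some (Sum.inr (a.1, j.castSucc))) a.2),
    Sum.elim (fun _ => none)
      -- Each form `p` uses its own copy of message bit `j`; hence no bit occurs twice in this slot.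
      (fun a => Fin.cases none (fun j => if s a.1 j = 1 then some (Sum.inl (j, a.1)) else none)
        a.2)]

theorem check_cases (a : Check k M) : (∃ i p, a = Sum.inl (i, p)) ∨ (∃ p, a = Sum.inr (p, 0)) ∨
    ∃ p j, a = Sum.inr (p, Fin.succ j) := by
  rcases a with ⟨i, p⟩ | ⟨p, j⟩
  · exact Or.inl ⟨i, p, rfl⟩
  · obtain rfl | ⟨j, rfl⟩ := Fin.eq_zero_or_eq_succ j
    · exact Or.inr (Or.inl ⟨p, rfl⟩)
    · exact Or.inr (Or.inr ⟨p, j, rfl⟩)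

theorem chk_inj (s : Fin (M + 1) → Fin k → ZMod 2) (r : Fin 3) (a a' : Check k M) (b : Bit k M)
    (h : chk s r a = some b) (h' : chk s r a' = some b) : a = a' := by
  obtain ⟨i, p, rfl⟩ | ⟨p, rfl⟩ | ⟨p, j, rfl⟩ := check_cases a <;>
    obtain ⟨i', p', rfl⟩ | ⟨p', rfl⟩ | ⟨p', j', rfl⟩ := check_cases a' <;>
    fin_cases r <;> simp [chk] at h h' ⊢ <;> grind [Fin.castSucc_inj]

/-- The encoding map. -/
def enc (s : Fin (M + 1) → Fin k → ZMod 2) :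
    (Fin k → ZMod 2) →ₗ[ZMod 2] (Bit k M → ZMod 2) :=
  LinearMap.pi (Sum.elim (fun b => LinearMap.proj b.1)
    (fun b => initialSum (fun i => s b.1 i • LinearMap.proj i) b.2))

theorem enc_inl (s : Fin (M + 1) → Fin k → ZMod 2) (z : Fin k → ZMod 2) (i : Fin k)
    (p : Fin (M + 1)) : enc s z (Sum.inl (i, p)) = z i := rfl

theorem enc_inr (s : Fin (M + 1) → Fin k → ZMod 2) (z : Fin k → ZMod 2) (p : Fin (M + 1))
    (j : Fin (k + 1)) : enc s z (Sum.inr (p, j)) = initialSum (fun i => s p i * z i) j := by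
  simp [enc, initialSum]

/-- The parity check map. -/
def checkMap (s : Fin (M + 1) → Fin k → ZMod 2) :
    (Bit k M → ZMod 2) →ₗ[ZMod 2] (Check k M → ZMod 2) where
  toFun v a := ∑ r, (chk s r a).elim 0 v
  map_add' v v' := by
    funext a
    simp only [Pi.add_apply, ← Finset.sum_add_distrib]
    refine Finset.sum_congr rfl fun r _ => ?_
    cases chk s r a <;> simp
  map_smul' c v := by
    funext a
    simp only [Pi.smul_apply, smul_eq_mul, RingHom.id_apply, Finset.mul_sum]
    refine Finset.sum_congr rfl fun r _ => ?_
    cases chk s r a <;> simp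

/-! ### Kernel and image of the parity checks -/

variable (s : Fin (M + 1) → Fin k → ZMod 2) (v : Bit k M → ZMod 2)

theorem checkMap_inl (i : Fin k) (p : Fin M) :
    checkMap s v (Sum.inl (i, p)) = v (Sum.inl (i, p.castSucc)) + v (Sum.inl (i, p.succ)) := by
  simp [checkMap, chk, Fin.sum_univ_three]

theorem checkMap_inr_zero (p : Fin (M + 1)) :
    checkMap s v (Sum.inr (p, 0)) = v (Sum.inr (p, 0)) := by
  simp [checkMap, chk, Fin.sum_univ_three]

theorem checkMap_inr_succ (p : Fin (M + 1)) (j : Fin k) :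
    checkMap s v (Sum.inr (p, j.succ)) =
      v (Sum.inr (p, j.succ)) + v (Sum.inr (p, j.castSucc)) + s p j * v (Sum.inl (j, p)) := by
  obtain h | h := eq_zero_or_one (s p j) <;> simp [checkMap, chk, Fin.sum_univ_three, h]

/-- The copy checks force all copies to agree, and the recursion then determines the partial sums.
-/
theorem checkMap_eq_zero_iff : checkMap s v = 0 ↔ ∃ z, enc s z = v := by
  constructor
  · intro h
    have hcopy : ∀ i p, v (Sum.inl (i, p)) = v (Sum.inl (i, 0)) := by
      intro i p
      induction p using Fin.induction with
      | zero => rfl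
      | succ p ih =>
        have := congrFun h (Sum.inl (i, p))
        rw [checkMap_inl, Pi.zero_apply, CharTwo.add_eq_zero] at this
        rw [← this, ih]
    refine ⟨fun i => v (Sum.inl (i, 0)), funext fun b => ?_⟩
    rcases b with ⟨i, p⟩ | ⟨p, j⟩
    · exact (hcopy i p).symm
    · rw [enc_inr]
      induction j using Fin.induction with
      | zero =>
        have := congrFun h (Sum.inr (p, 0))
        rw [checkMap_inr_zero] at this
        rw [initialSum_zero, this, Pi.zero_apply]
      | succ j ih =>
        have := congrFun h (Sum.inr (p, j.succ))
        rw [checkMap_inr_succ, Pi.zero_apply, add_assoc, CharTwo.add_eq_zero] at this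
        rw [initialSum_succ, ih, this, hcopy j p]
  · rintro ⟨z, rfl⟩
    funext a
    rcases a with ⟨i, p⟩ | ⟨p, j⟩
    · rw [checkMap_inl, enc_inl, enc_inl, CharTwo.add_self_eq_zero, Pi.zero_apply]
    · induction j using Fin.cases with
      | zero => rw [checkMap_inr_zero, enc_inr, initialSum_zero, Pi.zero_apply]
      | succ j =>
        rw [checkMap_inr_succ, enc_inr, enc_inr, enc_inl, initialSum_succ, add_assoc,
          CharTwo.add_self_eq_zero, Pi.zero_apply]

/-- The system is triangular: the copies are solved for along each chain, then the partial sums. A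
linear right inverse supplies the corrections. -/
theorem checkMap_surjective : Function.Surjective (checkMap s) := by
  intro w
  refine ⟨Sum.elim (fun b => initialSum (fun q => w (Sum.inl (b.1, q))) b.2)
    (fun b => w (Sum.inr (b.1, 0)) + initialSum (fun i => w (Sum.inr (b.1, i.succ)) +
      s b.1 i * initialSum (fun q => w (Sum.inl (i, q))) b.1) b.2), funext fun a => ?_⟩
  rcases a with ⟨i, p⟩ | ⟨p, j⟩
  · rw [checkMap_inl]
    simp only [Sum.elim_inl]
    rw [initialSum_succ, ← add_assoc, CharTwo.add_self_eq_zero, zero_add]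
  · induction j using Fin.cases with
    | zero =>
      rw [checkMap_inr_zero]
      simp [initialSum_zero]
    | succ j =>
      rw [checkMap_inr_succ]
      simp only [Sum.elim_inl, Sum.elim_inr]
      rw [initialSum_succ]
      generalize w (Sum.inr (p, 0)) = x
      generalize initialSum (fun i => w (Sum.inr (p, i.succ)) + _) j.castSucc = y
      generalize s p j * _ = z
      generalize w (Sum.inr (p, j.succ)) = t
      revert x y z t
      decide

theorem card_bit : Fintype.card (Bit k M) = Fintype.card (Check k M) + Fintype.card (Fin k) := by
  simp only [Fintype.card_sum, Fintype.card_prod, Fintype.card_fin]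
  ring

/-- The scheme that prepares the code and gives the phase `exp (i (-1)ᵃ θ p)` to the value `a` of the
linear form labelled by `p`, provided that the input bit `c p` is `1`. -/
noncomputable def scheme {ι : Type} (c : Fin (M + 1) → ι) (θ : Fin (M + 1) → ℝ) :
    Scheme ι (Fin k) (Check k M) (Bit k M) where
  chk := chk s
  chk_inj := chk_inj s
  corr b := {a | ((checkMap s).exists_rightInverse_of_surjective
    (LinearMap.range_eq_top.2 (checkMap_surjective s))).choose (Pi.single a 1) b = 1}
  ctrl := Sum.elim (fun b => c b.2) (fun b => c b.1)
  -- Only the last partial sum, which is the full value of the form, is rotated; with angle `0` the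
  -- control is immaterial.
  angle := Sum.elim (fun _ => 0) (fun b => if b.2 = Fin.last k then θ b.1 else 0)
  out j := {b | enc s (Pi.single j 1) b = 1}

/-! ### Correction, output and phase of the scheme -/

variable {ι : Type} (c : Fin (M + 1) → ι) (θ : Fin (M + 1) → ℝ)

theorem syndrome_scheme : (scheme s c θ).syndrome v = checkMap s v := rfl

theorem syndrome_correction_scheme (w : Check k M → ZMod 2) :
    (scheme s c θ).syndrome ((scheme s c θ).correction w) = w := by
  have h := ((checkMap s).exists_rightInverse_of_surjective
    (LinearMap.range_eq_top.2 (checkMap_surjective s))).choose_spec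
  have hc : (scheme s c θ).correction w = ((checkMap s).exists_rightInverse_of_surjective
      (LinearMap.range_eq_top.2 (checkMap_surjective s))).choose w :=
    funext fun b => sum_filter_map_single _ w b
  rw [syndrome_scheme, hc]
  exact LinearMap.congr_fun h w

theorem output_scheme (j : Fin k) :
    (scheme s c θ).output v j = ∑ b, v b * enc s (Pi.single j 1) b := by
  simp only [Scheme.output, scheme, Finset.sum_filter]
  refine Finset.sum_congr rfl fun b _ => ?_
  obtain h | h := eq_zero_or_one (enc s (Pi.single j 1) b) <;> simp [h]

theorem sum_mul_enc (z : Fin k → ZMod 2) :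
    ∑ b, v b * enc s z b = ∑ j, (scheme s c θ).output v j * z j := by
  simp only [output_scheme, Finset.sum_mul]
  rw [Finset.sum_comm]
  refine Finset.sum_congr rfl fun b _ => ?_
  rw [LinearMap.pi_apply_eq_sum_univ (enc s) z, Finset.sum_apply, Finset.mul_sum]
  refine Finset.sum_congr rfl fun j _ => ?_
  have : (fun i => if j = i then (1 : ZMod 2) else 0) = Pi.single j 1 := by
    funext i
    simp [Pi.single_apply, eq_comm]
  rw [this, Pi.smul_apply, smul_eq_mul]
  ring

theorem enc_injective : Function.Injective (enc s) := fun _ _ h =>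
  funext fun i => congrFun h (Sum.inl (i, 0))

theorem output_scheme_surjective : Function.Surjective (scheme s c θ).output := by
  intro x
  -- With `x` on copy `0` and zeros elsewhere, pairing with the encoding of the `j`-th unit vector
  -- reads off `x j`.
  refine ⟨Sum.elim (fun b => if b.2 = 0 then x b.1 else 0) 0, funext fun j => ?_⟩
  rw [output_scheme, Fintype.sum_sum_type, Fintype.sum_prod_type]
  simp [enc_inl, Pi.single_apply]

theorem phase_scheme (y : ι → ZMod 2) (z : Fin k → ZMod 2) :
    (scheme s c θ).phase y (enc s z) = ∏ p, if y (c p) = 1 then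
      Complex.exp (((θ p * sgn (∑ i, s p i * z i) : ℝ) : ℂ) * Complex.I) else 1 := by
  rw [Scheme.phase, Fintype.prod_sum_type, Finset.prod_eq_one, one_mul, Fintype.prod_prod_type]
  · refine Finset.prod_congr rfl fun p _ => ?_
    rw [Fintype.prod_eq_single (Fin.last k)]
    · simp [scheme, enc_inr, initialSum_last]
    · intro j hj
      simp [scheme, hj]
  · intro b _
    simp [scheme]

end PartialParity
/-! ### The phase oracle and the Hadamard code -/

/-- Orthogonality of characters: the sum factors over the coordinates. -/
theorem sum_sgn_dotProduct {κ : Type*} [Fintype κ] [DecidableEq κ] (w : κ → ZMod 2) :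
    ∑ s : κ → ZMod 2, sgn (∑ i, s i * w i) = if w = 0 then 2 ^ Fintype.card κ else 0 := by
  have h2 : (Finset.univ : Finset (ZMod 2)) = {0, 1} := rfl
  have hone : ∀ b : ZMod 2, ∑ a : ZMod 2, sgn (a * b) = if b = 0 then 2 else 0 := by
    intro b
    obtain rfl | rfl := eq_zero_or_one b <;> simp [h2, sgn]
  simp only [sgn_sum]
  rw [← Fintype.piFinset_univ,
    ← Finset.prod_univ_sum (fun _ => Finset.univ) fun i a => sgn (a * w i)]
  simp only [hone]
  by_cases hw : w = 0
  · simp [hw]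
  · obtain ⟨i, hi⟩ := Function.ne_iff.1 hw
    rw [if_neg hw]
    exact Finset.prod_eq_zero (Finset.mem_univ i) (if_neg hi)

/-- For fixed `w` the angles add up to `π` if `w = z` and to `0` otherwise, so only `w = z` matters.
-/
theorem prod_phase {κ : Type*} [Fintype κ] [DecidableEq κ] (y : (κ → ZMod 2) → ZMod 2)
    (z : κ → ZMod 2) :
    (∏ p : (κ → ZMod 2) × (κ → ZMod 2), if y p.2 = 1 then
      Complex.exp (((Real.pi / 2 ^ Fintype.card κ * sgn (∑ i, p.1 i * p.2 i) *
        sgn (∑ i, p.1 i * z i) : ℝ) : ℂ) * Complex.I) else 1) = sgn (y z) := by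
  have hsum : ∀ w : κ → ZMod 2, (∏ s : κ → ZMod 2,
      Complex.exp (((Real.pi / 2 ^ Fintype.card κ * sgn (∑ i, s i * w i) *
        sgn (∑ i, s i * z i) : ℝ) : ℂ) * Complex.I)) = if w = z then -1 else 1 := by
    intro w
    rw [← Complex.exp_sum, ← Finset.sum_mul, ← Complex.ofReal_sum]
    have : ∀ s : κ → ZMod 2, Real.pi / 2 ^ Fintype.card κ * sgn (∑ i, s i * w i) *
        sgn (∑ i, s i * z i) = Real.pi / 2 ^ Fintype.card κ * sgn (∑ i, s i * (w + z) i) := by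
      intro s
      rw [mul_assoc, ← sgn_add, ← Finset.sum_add_distrib]
      simp only [Pi.add_apply, mul_add]
    simp only [this, ← Finset.mul_sum, sum_sgn_dotProduct, add_eq_zero_iff_eq]
    split_ifs
    · rw [div_mul_cancel₀ _ (by positivity), Complex.exp_pi_mul_I]
    · simp
  rw [Fintype.prod_prod_type_right]
  have hw : ∀ w : κ → ZMod 2, (∏ s : κ → ZMod 2, if y w = 1 then
      Complex.exp (((Real.pi / 2 ^ Fintype.card κ * sgn (∑ i, s i * w i) *
        sgn (∑ i, s i * z i) : ℝ) : ℂ) * Complex.I) else 1) =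
      if w = z then (sgn (y z) : ℂ) else 1 := by
    intro w
    obtain h | h := eq_zero_or_one (y w)
    · simp only [h, zero_ne_one, if_false, Finset.prod_const_one]
      split_ifs with hwz
      · rw [← hwz, h, sgn_zero, Complex.ofReal_one]
      · rfl
    · simp only [h, if_true, hsum]
      split_ifs with hwz
      · rw [← hwz, h, sgn_one]
        simp
      · rfl
  simp only [hw]
  simp

/-- Agreements count `1` and disagreements `-1`. -/
theorem sum_sgn_hadamardCode {k : ℕ} (y : (Fin k → ZMod 2) → ZMod 2) (x : Fin k → ZMod 2) :
    ∑ z, sgn (∑ j, x j * z j) * sgn (y z) = 2 ^ k - 2 * (hammingDist y (hadamardCode x) : ℝ) := by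
  have h : ∀ z, sgn (∑ j, x j * z j) * sgn (y z) =
      1 - 2 * if y z ≠ hadamardCode x z then 1 else 0 := by
    intro z
    have hz : ∑ j, x j * z j = hadamardCode x z :=
      Finset.sum_congr rfl fun j _ => mul_comm _ _
    rw [hz]
    obtain h | h := eq_zero_or_one (y z) <;>
      obtain h' | h' := eq_zero_or_one (hadamardCode x z) <;> simp [h, h', sgn] <;> norm_num
  simp only [h, Finset.sum_sub_distrib, ← Finset.mul_sum, Finset.sum_boole, hammingDist]
  simp

/-- The number of pairs of words of length `k`, minus one. -/
abbrev lastIndex (k : ℕ) : ℕ := 2 ^ k * 2 ^ k - 1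

theorem lastIndex_add_one (k : ℕ) : lastIndex k + 1 = 2 ^ k * 2 ^ k :=
  Nat.sub_add_cancel (Nat.mul_pos (by positivity) (by positivity))

/-- An enumeration of the pairs of words. -/
noncomputable def pairEquiv (k : ℕ) :
    Fin (lastIndex k + 1) ≃ (Fin k → ZMod 2) × (Fin k → ZMod 2) :=
  (Fintype.equivFinOfCardEq (by simp [lastIndex_add_one])).symm

/-- The scheme that decodes the Hadamard code. -/
noncomputable def hadamardScheme (k : ℕ) :
    Scheme (Fin k → ZMod 2) (Fin k) (PartialParity.Check k (lastIndex k))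
      (PartialParity.Bit k (lastIndex k)) :=
  PartialParity.scheme (fun p => (pairEquiv k p).1) (fun p => (pairEquiv k p).2)
    fun p => Real.pi / 2 ^ k * sgn (∑ i, (pairEquiv k p).1 i * (pairEquiv k p).2 i)

theorem prob_hadamardScheme (k : ℕ) (y : (Fin k → ZMod 2) → ZMod 2) (x : Fin k → ZMod 2) :
    (hadamardScheme k).circuit.prob y x =
      ((2 ^ k - 2 * (hammingDist y (hadamardCode x) : ℝ)) / 2 ^ k) ^ 2 := by
  rw [hadamardScheme, Scheme.prob_circuit_of_encoding _
    (PartialParity.syndrome_correction_scheme _ _ _)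
    (PartialParity.output_scheme_surjective _ _ _) PartialParity.card_bit _
    (PartialParity.enc_injective _) (fun v => PartialParity.checkMap_eq_zero_iff _ v)
    (fun v z => PartialParity.sum_mul_enc _ v _ _ z)]
  have hphase : ∀ z, (∏ p, if y (pairEquiv k p).2 = 1 then
      Complex.exp (((Real.pi / 2 ^ k * sgn (∑ i, (pairEquiv k p).1 i * (pairEquiv k p).2 i) *
        sgn (∑ i, (pairEquiv k p).1 i * z i) : ℝ) : ℂ) * Complex.I) else 1) =
      (sgn (y z) : ℂ) := by
    intro z
    have h := prod_phase y z
    rw [Fintype.card_fin] at h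
    rw [← h]
    exact (pairEquiv k).prod_comp fun p => if y p.2 = 1 then
      Complex.exp (((Real.pi / 2 ^ k * sgn (∑ i, p.1 i * p.2 i) *
        sgn (∑ i, p.1 i * z i) : ℝ) : ℂ) * Complex.I) else 1
  simp only [PartialParity.phase_scheme, hphase, ← Complex.ofReal_mul, ← Complex.ofReal_sum,
    sum_sgn_hadamardCode, Complex.norm_real, Fintype.card_fin, Real.norm_eq_abs]
  rw [div_pow, sq_abs, div_pow]

theorem isQNC0Parity_hadamardScheme : IsQNC0Parity fun k => (hadamardScheme k).circuit := by
  refine ⟨⟨11, fun k => (Scheme.depth_circuit _).le⟩,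
    -- With `n²` linear forms and `k ≤ n`, both bits and checks number at most `n²(2n + 1)`; `15 = 9
    -- + 6` comes from `size_circuit_le`.
    15 * (.X ^ 2 * (2 * .X + 1)) + 2 * .X, fun k => (Scheme.size_circuit_le _).trans ?_⟩
  have hk : k ≤ 2 ^ k := Nat.lt_two_pow_self.le
  have hM := lastIndex_add_one k
  have hP : lastIndex k ≤ 2 ^ k * 2 ^ k := Nat.sub_le _ _
  simp only [Fintype.card_sum, Fintype.card_prod, Fintype.card_fin, Fintype.card_fun, ZMod.card,
    Polynomial.eval_add, Polynomial.eval_mul, Polynomial.eval_pow, Polynomial.eval_X,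
    Polynomial.eval_ofNat, Polynomial.eval_one]
  rw [hM]
  generalize lastIndex k = m at hP
  generalize 2 ^ k = n at *
  have h1 : k * m ≤ k * (n * n) := Nat.mul_le_mul_left _ hP
  have h2 : k * (n * n) ≤ n * (n * n) := Nat.mul_le_mul_right _ hk
  nlinarith

end ParityQC

/-! ### The decoding theorem -/

theorem theorem2p2 :
    ∃ C : (k : ℕ) → ParityQC.Circuit (Fin k → ZMod 2) (Fin k),
      ParityQC.IsQNC0Parity C ∧
      ∃ c : ℝ, 0 < c ∧
        ∀ (k : ℕ) (ε : ℝ), 0 < ε → ε ≤ 1 / 2 →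
          ∀ (y : (Fin k → ZMod 2) → ZMod 2) (x : Fin k → ZMod 2),
            (hammingDist y (hadamardCode x) : ℝ) ≤ (1 / 2 - ε) * (2 : ℝ) ^ k →
              c * ε ^ 2 ≤ (C k).prob y x := by
  -- The constant `4` arises from squaring `1 - 2d/n ≥ 2ε`.
  refine ⟨fun k => (ParityQC.hadamardScheme k).circuit, ParityQC.isQNC0Parity_hadamardScheme, 4,
    by norm_num, fun k ε hε _ y x h => ?_⟩
  have hn : (0 : ℝ) < 2 ^ k := by positivity
  have hcorr : 2 * ε ≤ (2 ^ k - 2 * (hammingDist y (hadamardCode x) : ℝ)) / 2 ^ k := by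
    rw [le_div_iff₀ hn]
    linarith
  calc 4 * ε ^ 2 = (2 * ε) ^ 2 := by ring
    _ ≤ _ := by
      rw [ParityQC.prob_hadamardScheme]
      exact pow_le_pow_left₀ (by positivity) hcorr 2
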